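/- Let $W$ be a finite set, let $r\ge 0$, and let $\mathtt{N}=\{N_1,\ldots,N_r\}$ be a sequence of subsets of $W$ (repetitions and empty sets are allowed). Let $a_1,\ldots,a_r$ be distinct points not in $W$, and put $\widetilde{N}_i=N_i\sqcup\{a_i\}$. Let $K(\mathtt{N})$ be the simplicial complex on the vertex set $W\sqcup\{a_1,\ldots,a_r\}$ (ghost vertices are allowed) whose minimal non-faces are $\widetilde{N}_1,\ldots,\widetilde{N}_r$; that is, a set of vertices is a simplex of $K(\mathtt{N})$ if and only if it contains none of the $\widetilde{N}_i$. Let $|K(\mathtt{N})|$ denote its geometric realization. Then $$|K(\mathtt{N})|\simeq\begin{cases}S^{|W|-1}&\text{if }N_1\cup\cdots\cup N_r=W,\\ *&\text{otherwise,}\end{cases}$$ where $S^{-1}=\emptyset$. Moreover, if $\mathtt{M}=\{M_1,\ldots,M_r\}$ is a sequence of subsets of $W$ such that $M_i\subset N_i$ for all $i$ and $M_1\cup\cdots\cup M_r=W$, then $K(\mathtt{M})$, formed with the same points $a_1,\ldots,a_r$, is a subcomplex of $K(\mathtt{N})$, and the inclusion $|K(\mathtt{M})|\to|K(\mathtt{N})|$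 is a homotopy equivalence. -/

import Mathlib

open scoped ContinuousMap

namespace SimplicialComplexOf

section General

variable {V : Type*}

/-- A minimal non-face of a simplicial complex `K` on the vertex set `V`: a non-empty finite set of
vertices which is not a face of `K`, minimal with this property. Not every element of `V` has to be
a face of `K`, that is, `K` may have ghost vertices. The empty simplex, which is not listed among
the faces of a `PreAbstractSimplicialComplex`, is never counted as a non-face. -/
def IsMinimalNonface (K : PreAbstractSimplicialComplex V) (s : Finset V) : Prop :=
  Minimal (fun t : Finset V => t.Nonempty ∧ t ∉ K) s

/-- The geometric realization of a simplicial complex on a finite vertex set `V`: the subspace of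
`V → ℝ` consisting of the points of the standard simplex (barycentric coordinates) which are
supported on a face of `K`. It carries the subspace topology of `V → ℝ`. -/
def realization [Fintype V] (K : PreAbstractSimplicialComplex V) : Set (V → ℝ) :=
  {x | x ∈ stdSimplex ℝ V ∧ ∃ s ∈ K, ∀ v, v ∉ s → x v = 0}

theorem realization_mono [Fintype V] {K L : PreAbstractSimplicialComplex V} (h : K ≤ L) :
    realization K ⊆ realization L :=
  fun _ ⟨hx, s, hs, hxs⟩ => ⟨hx, s, h hs, hxs⟩

/-- The inclusion `|K| → |L|` of the realizations, for a subcomplex `K` of `L`. -/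
def realizationInclusion [Fintype V] {K L : PreAbstractSimplicialComplex V} (h : K ≤ L) :
    C(realization K, realization L) where
  toFun := Set.inclusion (realization_mono h)
  continuous_toFun := continuous_inclusion (realization_mono h)

/-- A continuous map is a homotopy equivalence if it has a homotopy inverse. -/
def IsHomotopyEquivalence {X Y : Type*} [TopologicalSpace X] [TopologicalSpace Y]
    (f : C(X, Y)) : Prop :=
  ∃ e : X ≃ₕ Y, e.toFun = f

end General

section Construction

variable {W : Type*} {r : ℕ}

/-- The set `Ñ i = N i ⊔ {a i}`; the new point `a i` is `Sum.inr i`, and the vertex set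
`V = W ⊔ {a 1, …, a r}` is `W ⊕ Fin r`. -/
def extended (N : Fin r → Finset W) (i : Fin r) : Finset (W ⊕ Fin r) :=
  (N i).disjSum {i}

/-- The simplicial complex `K(N)` on the vertex set `W ⊕ Fin r` whose minimal non-faces are the sets
`Ñ i`: its faces are the non-empty sets of vertices that contain none of the `Ñ i`. It is the only
complex with these minimal non-faces, see `eq_complex_iff`. -/
def complex (N : Fin r → Finset W) : PreAbstractSimplicialComplex (W ⊕ Fin r) where
  faces := {s | s.Nonempty ∧ ∀ i, ¬ extended N i ⊆ s}
  isRelLowerSet_faces := fun _ hs =>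
    ⟨hs.1, fun _ hts ht => ⟨ht, fun i hi => hs.2 i (hi.trans hts)⟩⟩

theorem mem_complex {N : Fin r → Finset W} {s : Finset (W ⊕ Fin r)} :
    s ∈ complex N ↔ s.Nonempty ∧ ∀ i, ¬ extended N i ⊆ s :=
  Iff.rfl

theorem extended_nonempty (N : Fin r → Finset W) (i : Fin r) : (extended N i).Nonempty :=
  ⟨Sum.inr i, by simp [extended]⟩

/-- The minimal non-faces of `K(N)` are exactly the sets `Ñ i`. -/
theorem isMinimalNonface_complex_iff (N : Fin r → Finset W) (s : Finset (W ⊕ Fin r)) :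
    IsMinimalNonface (complex N) s ↔ ∃ i, s = extended N i := by
  have key : ∀ t : Finset (W ⊕ Fin r),
      (t.Nonempty ∧ t ∉ complex N) ↔ ∃ i, extended N i ⊆ t := by
    intro t
    rw [mem_complex]
    constructor
    · rintro ⟨h1, h2⟩
      by_contra h3
      exact h2 ⟨h1, fun i hi => h3 ⟨i, hi⟩⟩
    · rintro ⟨i, hi⟩
      exact ⟨(extended_nonempty N i).mono hi, fun h => h.2 i hi⟩
  unfold IsMinimalNonface
  simp only [key]
  constructor
  · rintro ⟨⟨i, hi⟩, hmin⟩
    exact ⟨i, (hmin ⟨i, subset_rfl⟩ hi).antisymm hi⟩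
  · rintro ⟨i, rfl⟩
    refine ⟨⟨i, subset_rfl⟩, ?_⟩
    rintro t ⟨j, hj⟩ hti
    have hji : j = i := by
      have h1 : (Sum.inr j : W ⊕ Fin r) ∈ extended N i :=
        hti (hj (by simp [extended]))
      simpa [extended] using h1
    exact hji ▸ hj

/-- `K(N)` is the unique simplicial complex on `W ⊕ Fin r` with minimal non-faces the `Ñ i`. -/
theorem eq_complex_iff (N : Fin r → Finset W) (L : PreAbstractSimplicialComplex (W ⊕ Fin r)) :
    L = complex N ↔ ∀ s, IsMinimalNonface L s ↔ ∃ i, s = extended N i := by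
  constructor
  · rintro rfl
    exact isMinimalNonface_complex_iff N
  · intro h
    apply SetLike.ext
    intro s
    rw [mem_complex]
    constructor
    · intro hs
      refine ⟨(L.isRelLowerSet_faces hs).1, fun i hi => ?_⟩
      have hm : IsMinimalNonface L (extended N i) := (h _).2 ⟨i, rfl⟩
      exact hm.1.2 ((L.isRelLowerSet_faces hs).2 hi (extended_nonempty N i))
    · rintro ⟨h1, h2⟩
      by_contra hs
      obtain ⟨t, hts, ht⟩ := exists_minimal_le_of_wellFoundedLT
        (fun t : Finset (W ⊕ Fin r) => t.Nonempty ∧ t ∉ L) s ⟨h1, hs⟩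
      obtain ⟨i, rfl⟩ := (h t).1 ht
      exact h2 i hts

/-- If `M i ⊆ N i` for all `i`, then `K(M)` is a subcomplex of `K(N)`. -/
theorem complex_mono {M N : Fin r → Finset W} (h : ∀ i, M i ⊆ N i) : complex M ≤ complex N :=
  fun _ hs => ⟨hs.1, fun i hi => hs.2 i ((Finset.disjSum_mono (h i) subset_rfl).trans hi)⟩

end Construction

end SimplicialComplexOf

namespace SimplicialComplexOf

section HomotopyEquivalence

/-! A point of `W` in no `N i` is a cone point. If the `N i` cover `W`, choosing for each `w` an
index `c w` with `w ∈ N (c w)` gives a partition of `W` into `fibres c i ⊆ N i`, and the inclusion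
statement reduces the problem to that partition. There the complex is the join of the boundaries of
the simplices on the `Ñ i`. Its cone is a complete simplicial fan: `coneToVector` identifies it with
`W → ℝ`, and radial projection gives the sphere.

The inclusion is treated one deleted point at a time (`isHomotopyEquivalence_of_erase`). Deleting
`w` from `N i` removes the open star of the simplex `S = Ñ i \ {w}`. Faces containing `S` miss `w`,
so they stay faces when `a j` is added, where `w ∈ N j`. Thus the link of `S` is a cone with apex `a
j`, and the star can be pushed off `S`. -/

theorem IsHomotopyEquivalence.comp {X Y Z : Type*} [TopologicalSpace X] [TopologicalSpace Y]
    [TopologicalSpace Z] {g : C(Y, Z)} {f : C(X, Y)} (hg : IsHomotopyEquivalence g)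
    (hf : IsHomotopyEquivalence f) : IsHomotopyEquivalence (g.comp f) := by
  obtain ⟨e, rfl⟩ := hf
  obtain ⟨e', rfl⟩ := hg
  exact ⟨e.trans e', rfl⟩

/-- A displacement field `D` that moves `B` inside itself into the subset `A` along straight lines,
and that vanishes on `A`, exhibits the inclusion of `A` into `B` as a homotopy equivalence. -/
theorem isHomotopyEquivalence_of_displacement {E : Type*} [AddCommGroup E] [Module ℝ E]
    [TopologicalSpace E] [ContinuousAdd E] [ContinuousSMul ℝ E] {A B : Set E} (f : C(A, B))
    (hf : ∀ a, (f a : E) = a) (D : E → E) (hD : Continuous D)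
    (hB : ∀ z ∈ B, ∀ t : ℝ, 0 ≤ t → t ≤ 1 → z + t • D z ∈ B)
    (hA : ∀ z ∈ B, z + D z ∈ A) (hfix : ∀ z ∈ A, D z = 0) :
    IsHomotopyEquivalence f := by
  let g : C(B, A) := ⟨fun z => ⟨z + D z, hA z z.2⟩, by fun_prop⟩
  have hgf : g.comp f = ContinuousMap.id A := by
    ext a
    simp [g, hf, hfix a a.2]
  let H : ContinuousMap.Homotopy (ContinuousMap.id B) (f.comp g) :=
    { toFun := fun p => ⟨(p.2 : E) + (p.1 : ℝ) • D p.2, hB p.2 p.2.2 p.1 p.1.2.1 p.1.2.2⟩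
      continuous_toFun := by fun_prop
      map_zero_left := fun z => by ext1; simp
      map_one_left := fun z => by ext1; simp [g, hf] }
  exact ⟨⟨f, g, hgf ▸ .refl _, ⟨H.symm⟩⟩, rfl⟩

end HomotopyEquivalence

/-! ### Coordinates on the realization, and the cone case -/

variable {W : Type*} {r : ℕ}

@[simp]
theorem inl_mem_extended {N : Fin r → Finset W} {i : Fin r} {w : W} :
    Sum.inl w ∈ extended N i ↔ w ∈ N i := by
  simp [extended]

@[simp]
theorem inr_mem_extended {N : Fin r → Finset W} {i k : Fin r} :
    Sum.inr k ∈ extended N i ↔ k = i := by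
  simp [extended]

/-- Faces are closed under non-empty subsets, so it suffices to test the support of `z`. -/
theorem mem_realization_complex [Fintype W] {N : Fin r → Finset W} {z : W ⊕ Fin r → ℝ} :
    z ∈ realization (complex N) ↔
      z ∈ stdSimplex ℝ (W ⊕ Fin r) ∧ ∀ i, ∃ v ∈ extended N i, z v = 0 := by
  classical
  refine and_congr_right fun hz => ⟨?_, fun h => ?_⟩
  · rintro ⟨s, hs, hzs⟩ i
    obtain ⟨v, hv, hvs⟩ := Finset.not_subset.1 (hs.2 i)
    exact ⟨v, hv, hzs v hvs⟩
  · refine ⟨Finset.univ.filter fun v => z v ≠ 0, ⟨?_, fun i hi => ?_⟩, fun v hv => by simpa using hv⟩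
    · have : ∑ v, z v ≠ 0 := by rw [hz.2]; exact one_ne_zero
      obtain ⟨v, -, hv⟩ := Finset.exists_ne_zero_of_sum_ne_zero this
      exact ⟨v, by simpa using hv⟩
    · obtain ⟨v, hv, hv0⟩ := h i
      simpa [hv0] using hi hv

/-- A point of `W` that lies in none of the `N i` is a cone point of `K(N)`. -/
theorem contractibleSpace_realization_complex [Fintype W] {N : Fin r → Finset W}
    (h : (⋃ i, (N i : Set W)) ≠ Set.univ) :
    ContractibleSpace (realization (complex N)) := by
  classical
  obtain ⟨w, hw⟩ := (Set.ne_univ_iff_exists_notMem _).1 h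
  simp only [Set.mem_iUnion, Finset.mem_coe, not_exists] at hw
  have hne : ∀ i, ∀ v ∈ extended N i, v ≠ Sum.inl w := by
    rintro i v hv rfl
    exact hw i (inl_mem_extended.1 hv)
  have hp : (Pi.single (Sum.inl w) 1 : W ⊕ Fin r → ℝ) ∈ realization (complex N) := by
    refine mem_realization_complex.2 ⟨single_mem_stdSimplex ℝ _, fun i => ⟨Sum.inr i, by simp, ?_⟩⟩
    simp
  have hstar : StarConvex ℝ (Pi.single (Sum.inl w) 1 : W ⊕ Fin r → ℝ)
      (realization (complex N)) := by
    intro z hz a b ha hb hab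
    rw [mem_realization_complex] at hz ⊢
    refine ⟨convex_stdSimplex ℝ _ (single_mem_stdSimplex ℝ _) hz.1 ha hb hab, fun i => ?_⟩
    obtain ⟨v, hv, hv0⟩ := hz.2 i
    exact ⟨v, hv, by simp [hv0, hne i v hv]⟩
  exact hstar.contractibleSpace ⟨_, hp⟩

/-! ### Shrinking the sets of a cover -/

section Inclusion

/-- Removing a point `w` from `N i` does not change the homotopy type, provided that `w` also lies in
some other `N j`: the simplices that get lost are pushed towards the vertex `a j`. -/
theorem isHomotopyEquivalence_of_erase [Fintype W] [DecidableEq W] {N : Fin r → Finset W}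
    {i j : Fin r} (hij : j ≠ i) {w : W} (hwj : w ∈ N j)
    (h : ∀ k, Function.update N i ((N i).erase w) k ⊆ N k) :
    IsHomotopyEquivalence (realizationInclusion (complex_mono h)) := by
  classical
  set M := Function.update N i ((N i).erase w) with hM
  have hMi : M i = (N i).erase w := by simp [hM]
  have hMk : ∀ k, k ≠ i → extended M k = extended N k := fun k hk => by
    simp [hM, extended, Function.update_of_ne hk]
  set S := extended M i with hS
  have hSne : S.Nonempty := extended_nonempty M i
  have hjS : Sum.inr j ∉ S := by simpa [hS] using hij
  have hwS : Sum.inl w ∉ S := by simp [hS, hMi]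
  -- On `|K(N)|`, `m` vanishes exactly on `|K(M)|`. The direction `d` takes one unit from each
  -- vertex of `S` and gives all `S.card` units to `a j`, preserving the coordinate sum.
  let m : (W ⊕ Fin r → ℝ) → ℝ := fun z => S.inf' hSne z
  let d : W ⊕ Fin r → ℝ := fun v => (if v = Sum.inr j then (S.card : ℝ) else 0) -
    if v ∈ S then 1 else 0
  have hmc : Continuous m := Continuous.finset_inf'_apply hSne fun v _ => continuous_apply v
  have hm_le : ∀ z, ∀ v ∈ S, m z ≤ z v := fun z v hv => Finset.inf'_le _ hv
  have hm_nonneg : ∀ z ∈ stdSimplex ℝ (W ⊕ Fin r), 0 ≤ m z := fun z hz =>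
    Finset.le_inf' _ _ fun v _ => hz.1 v
  have hd_sum : ∑ v, d v = 0 := by
    simp [d, Finset.sum_sub_distrib]
  have hd_mem : ∀ v ∈ S, d v = -1 := fun v hv => by
    have : v ≠ Sum.inr j := fun h' => hjS (h' ▸ hv)
    simp [d, hv, this]
  have hd_zero : ∀ v, v ∉ S → v ≠ Sum.inr j → d v = 0 := fun v hv hvj => by
    simp [d, hv, hvj]
  have hd_nonneg : ∀ v, v ∉ S → 0 ≤ d v := fun v hv => by
    simp only [d, hv, if_false, sub_zero]
    split_ifs <;> positivity
  have hsimplex : ∀ z ∈ stdSimplex ℝ (W ⊕ Fin r), ∀ t : ℝ, 0 ≤ t → t ≤ 1 →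
      z + t • (m z • d) ∈ stdSimplex ℝ (W ⊕ Fin r) := by
    intro z hz t ht ht1
    refine ⟨fun v => ?_, ?_⟩
    · by_cases hv : v ∈ S
      · have h1 := hm_le z v hv
        have h2 := hm_nonneg z hz
        simp only [Pi.add_apply, Pi.smul_apply, smul_eq_mul, hd_mem v hv]
        nlinarith
      · have h2 := hm_nonneg z hz
        have h3 := hd_nonneg v hv
        have h4 := hz.1 v
        simp only [Pi.add_apply, Pi.smul_apply, smul_eq_mul]
        positivity
    · simp only [Pi.add_apply, Pi.smul_apply, smul_eq_mul, Finset.sum_add_distrib,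
        ← Finset.mul_sum, hd_sum, hz.2, mul_zero, add_zero]
  have hface : ∀ z ∈ realization (complex N), ∀ (t : ℝ) k,
      ∃ v ∈ extended N k, (z + t • (m z • d)) v = 0 := by
    intro z hz t k
    rw [mem_realization_complex] at hz
    rcases (hm_nonneg z hz.1).eq_or_lt with hm | hm
    · simpa [← hm] using hz.2 k
    have hpos : ∀ v, z v = 0 → v ∉ S := fun v hv hvS => by
      have := hm_le z v hvS
      linarith
    -- Outside `S` only the coordinate of `a j` changes, so only `Ñ j` may lose its zero. It has
    -- another one at `w`: as `m z > 0`, the zero of `z` in `Ñ i` can only be at `w`.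
    by_cases hk : k = j
    · subst hk
      refine ⟨Sum.inl w, by simpa using hwj, ?_⟩
      obtain ⟨v, hv, hv0⟩ := hz.2 i
      have hvw : v = Sum.inl w := by
        by_contra hne
        apply hpos v hv0
        rcases v with x | l
        · simp only [inl_mem_extended] at hv
          simp only [hS, inl_mem_extended, hMi, Finset.mem_erase]
          exact ⟨fun hx => hne (hx ▸ rfl), hv⟩
        · simpa [hS] using hv
      subst hvw
      simp [hv0, hd_zero _ hwS (by simp)]
    · obtain ⟨v, hv, hv0⟩ := hz.2 k
      refine ⟨v, hv, ?_⟩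
      have hvj : v ≠ Sum.inr j := by
        rintro rfl
        exact hk (inr_mem_extended.1 hv).symm
      simp [hv0, hd_zero v (hpos v hv0) hvj]
  refine isHomotopyEquivalence_of_displacement _ (fun _ => rfl) (fun z => m z • d)
    (by fun_prop) ?_ ?_ ?_
  · intro z hz t ht ht1
    exact mem_realization_complex.2
      ⟨hsimplex z (mem_realization_complex.1 hz).1 t ht ht1, hface z hz t⟩
  · intro z hz
    have h1 := hsimplex z (mem_realization_complex.1 hz).1 1 zero_le_one le_rfl
    have h2 := hface z hz 1
    rw [one_smul] at h1 h2
    refine mem_realization_complex.2 ⟨h1, fun k => ?_⟩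
    by_cases hk : k = i
    · subst hk
      -- At time 1 the smallest coordinate on `S` has just reached 0.
      obtain ⟨v, hv, hmv⟩ := Finset.exists_mem_eq_inf' hSne z
      refine ⟨v, hv, ?_⟩
      have : m z = z v := hmv
      simp [hd_mem v hv, this]
    · rw [hMk k hk]
      exact h2 k
  · intro z hz
    obtain ⟨hz1, hz2⟩ := mem_realization_complex.1 hz
    obtain ⟨v, hv, hv0⟩ := hz2 i
    have : m z = 0 := le_antisymm (hv0 ▸ hm_le z v hv) (hm_nonneg z hz1)
    simp [this]

/-- The inclusion `|K(M)| → |K(N)|` is a homotopy equivalence if the `M i` cover `W`. -/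
theorem isHomotopyEquivalence_realizationInclusion [Fintype W] {M N : Fin r → Finset W}
    (hMN : ∀ i, M i ⊆ N i) (hM : (⋃ i, (M i : Set W)) = Set.univ) :
    IsHomotopyEquivalence (realizationInclusion (complex_mono hMN)) := by
  classical
  -- `M` stays fixed while `N` shrinks to it; since `M` covers `W`, each deleted point still lies in
  -- another set.
  induction hn : ∑ i, (N i).card using Nat.strong_induction_on generalizing N with
  | _ n ih =>
    by_cases hEq : M = N
    · subst hEq
      exact ⟨.refl _, rfl⟩
    · obtain ⟨i, hi⟩ := Function.ne_iff.1 hEq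
      obtain ⟨w, hwN, hwM⟩ := Finset.exists_of_ssubset ((hMN i).ssubset_of_ne hi)
      obtain ⟨j, hj⟩ := Set.mem_iUnion.1 (hM ▸ Set.mem_univ w)
      have hij : j ≠ i := by
        rintro rfl
        exact hwM hj
      set N' := Function.update N i ((N i).erase w) with hN'
      have hN'i : N' i = (N i).erase w := by simp [hN']
      have hN'k : ∀ k, k ≠ i → N' k = N k := fun k hk => by simp [hN', hk]
      have h1 : ∀ k, N' k ⊆ N k := fun k => by
        by_cases hk : k = i
        · subst hk
          exact hN'i ▸ Finset.erase_subset _ _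
        · exact (hN'k k hk).subset
      have h2 : ∀ k, M k ⊆ N' k := fun k => by
        by_cases hk : k = i
        · subst hk
          exact hN'i ▸ Finset.subset_erase.2 ⟨hMN k, hwM⟩
        · exact (hN'k k hk).symm ▸ hMN k
      have hlt : ∑ k, (N' k).card < n := by
        rw [← hn]
        refine Finset.sum_lt_sum (fun k _ => Finset.card_le_card (h1 k)) ⟨i, Finset.mem_univ i, ?_⟩
        rw [hN'i]
        exact Finset.card_erase_lt_of_mem hwN
      exact (isHomotopyEquivalence_of_erase hij (hMN j hj) h1).comp (ih _ hlt h2 rfl)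

end Inclusion

/-! ### Partitions: the fan and the sphere -/

section Partition

/-- The cone over the realization of `K(N)`. -/
def realizationCone (N : Fin r → Finset W) : Set (W ⊕ Fin r → ℝ) :=
  {z | (∀ v, 0 ≤ z v) ∧ ∀ i, ∃ v ∈ extended N i, z v = 0}

theorem smul_mem_realizationCone {N : Fin r → Finset W} {z : W ⊕ Fin r → ℝ}
    (hz : z ∈ realizationCone N) {a : ℝ} (ha : 0 ≤ a) : a • z ∈ realizationCone N :=
  ⟨fun v => mul_nonneg ha (hz.1 v), fun i =>
    let ⟨v, hv, hv0⟩ := hz.2 i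
    ⟨v, hv, by simp [hv0]⟩⟩

/-- The linear map sending a vertex `w` to the basis vector `e w`, and the vertex `a i` to minus the
sum of the basis vectors in the `i`-th fibre of `c`. -/
def coneToVector (c : W → Fin r) : (W ⊕ Fin r → ℝ) →ₗ[ℝ] (W → ℝ) where
  toFun z w := z (Sum.inl w) - z (Sum.inr (c w))
  map_add' x y := by ext w; simp; ring
  map_smul' a x := by ext w; simp; ring

@[simp]
theorem coneToVector_apply (c : W → Fin r) (z : W ⊕ Fin r → ℝ) (w : W) :
    coneToVector c z w = z (Sum.inl w) - z (Sum.inr (c w)) := rfl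

variable [Fintype W]

theorem realization_subset_cone (N : Fin r → Finset W) :
    realization (complex N) ⊆ realizationCone N := fun _ hz =>
  have h := mem_realization_complex.1 hz
  ⟨h.1.1, h.2⟩

open Classical in
/-- The partition of `W` into the fibres of `c`. -/
noncomputable def fibres (c : W → Fin r) (i : Fin r) : Finset W :=
  Finset.univ.filter fun w => c w = i

@[simp]
theorem mem_fibres {c : W → Fin r} {i : Fin r} {w : W} : w ∈ fibres c i ↔ c w = i := by
  simp [fibres]

/-- The largest negative part of the coordinates of `u` in the `i`-th fibre of `c`. -/
noncomputable def fibreSup (c : W → Fin r) (u : W → ℝ) (i : Fin r) : NNReal :=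
  (fibres c i).sup fun w => (-u w).toNNReal

theorem continuous_fibreSup (c : W → Fin r) (i : Fin r) :
    Continuous fun u : W → ℝ => fibreSup c u i :=
  Continuous.finset_sup_apply fun w _ => by fun_prop

/-- The inverse of `coneToVector` on the cone over `K(fibres c)`. -/
noncomputable def vectorToCone (c : W → Fin r) (u : W → ℝ) : W ⊕ Fin r → ℝ :=
  Sum.elim (fun w => u w + fibreSup c u (c w)) fun i => fibreSup c u i

theorem continuous_vectorToCone (c : W → Fin r) : Continuous (vectorToCone c) := by
  have := continuous_fibreSup c
  refine continuous_pi fun v => ?_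
  rcases v with w | i
  · exact (continuous_apply w).add (NNReal.continuous_coe.comp (this _))
  · exact NNReal.continuous_coe.comp (this _)

theorem neg_le_fibreSup (c : W → Fin r) (u : W → ℝ) (w : W) : -u w ≤ fibreSup c u (c w) :=
  (Real.le_coe_toNNReal _).trans <| NNReal.coe_le_coe.2 <|
    Finset.le_sup (f := fun w => (-u w).toNNReal) (mem_fibres.2 rfl)

theorem vectorToCone_mem (c : W → Fin r) (u : W → ℝ) :
    vectorToCone c u ∈ realizationCone (fibres c) := by
  refine ⟨fun v => ?_, fun i => ?_⟩
  · rcases v with w | i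
    · have := neg_le_fibreSup c u w
      simp only [vectorToCone, Sum.elim_inl]
      linarith
    · exact NNReal.coe_nonneg _
  -- A zero supremum, which includes the empty fibre, makes the coordinate of `a i` vanish. A
  -- positive one is attained at some `w`, where `u w` cancels it.
  · by_cases h0 : fibreSup c u i = 0
    · exact ⟨Sum.inr i, by simp, by simp [vectorToCone, h0]⟩
    · have hne : (fibres c i).Nonempty := by
        rw [Finset.nonempty_iff_ne_empty]
        intro he
        exact h0 (by simp [fibreSup, he])
      obtain ⟨w, hw, hsup⟩ := Finset.exists_mem_eq_sup (fibres c i) hne fun w => (-u w).toNNReal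
      change fibreSup c u i = _ at hsup
      refine ⟨Sum.inl w, by simpa using hw, ?_⟩
      have hpos : 0 < (-u w).toNNReal := by
        rw [← hsup]
        exact pos_iff_ne_zero.2 h0
      obtain rfl := mem_fibres.1 hw
      simp only [vectorToCone, Sum.elim_inl, hsup]
      rw [Real.coe_toNNReal _ (Real.toNNReal_pos.1 hpos).le, add_neg_cancel]

theorem coneToVector_vectorToCone (c : W → Fin r) (u : W → ℝ) :
    coneToVector c (vectorToCone c u) = u := by
  ext w
  simp [vectorToCone]

/-- Nonnegativity of `z` bounds the supremum by `z (a i)`; a zero of `z` on `Ñ i` forces equality.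
This makes `coneToVector` injective on the cone. -/
theorem fibreSup_coneToVector {c : W → Fin r} {z : W ⊕ Fin r → ℝ}
    (hz : z ∈ realizationCone (fibres c)) (i : Fin r) :
    (fibreSup c (coneToVector c z) i : ℝ) = z (Sum.inr i) := by
  apply le_antisymm
  · rw [← Real.coe_toNNReal _ (hz.1 (Sum.inr i)), NNReal.coe_le_coe]
    refine Finset.sup_le fun w hw => Real.toNNReal_le_toNNReal ?_
    obtain rfl := mem_fibres.1 hw
    have := hz.1 (Sum.inl w)
    simp only [coneToVector_apply]
    linarith
  · obtain ⟨v, hv, hv0⟩ := hz.2 i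
    rcases v with w | k
    · obtain rfl := mem_fibres.1 (inl_mem_extended.1 hv)
      simpa [hv0] using neg_le_fibreSup c (coneToVector c z) w
    · obtain rfl := inr_mem_extended.1 hv
      rw [hv0]
      exact NNReal.coe_nonneg _

theorem vectorToCone_coneToVector {c : W → Fin r} {z : W ⊕ Fin r → ℝ}
    (hz : z ∈ realizationCone (fibres c)) : vectorToCone c (coneToVector c z) = z := by
  ext v
  rcases v with w | i <;> simp [vectorToCone, fibreSup_coneToVector hz]

/-- Inherited from the linearity of the inverse map, as the cone is stable under nonnegative
scaling. -/
theorem vectorToCone_smul (c : W → Fin r) {a : ℝ} (ha : 0 ≤ a) (u : W → ℝ) :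
    vectorToCone c (a • u) = a • vectorToCone c u := by
  conv_lhs => rw [← coneToVector_vectorToCone c u, ← map_smul]
  exact vectorToCone_coneToVector (smul_mem_realizationCone (vectorToCone_mem c u) ha)

theorem sum_vectorToCone_pos (c : W → Fin r) {u : W → ℝ} (hu : u ≠ 0) :
    0 < ∑ v, vectorToCone c u v := by
  have hnn := (vectorToCone_mem c u).1
  refine (Finset.sum_nonneg fun v _ => hnn v).lt_of_ne' fun h0 => hu ?_
  have : vectorToCone c u = 0 := by
    ext v
    exact (Finset.sum_eq_zero_iff_of_nonneg fun v _ => hnn v).1 h0 v (Finset.mem_univ v)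
  rw [← coneToVector_vectorToCone c u, this, map_zero]

theorem coneToVector_ne_zero {c : W → Fin r} {z : W ⊕ Fin r → ℝ}
    (hz : z ∈ realization (complex (fibres c))) : coneToVector c z ≠ 0 := by
  intro h0
  have h1 := vectorToCone_coneToVector (realization_subset_cone _ hz)
  have h2 := vectorToCone_smul c le_rfl (0 : W → ℝ)
  rw [h0] at h1
  rw [zero_smul, zero_smul, h1] at h2
  have h3 := (mem_realization_complex.1 hz).1.2
  simp [h2] at h3

/-- For a partition of `W`, the realization of the complex is homeomorphic to the unit sphere of any
normed space isomorphic to `W → ℝ`. -/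
noncomputable def realizationFibresHomeomorph {E : Type*} [NormedAddCommGroup E] [NormedSpace ℝ E]
    (L : E ≃L[ℝ] (W → ℝ)) (c : W → Fin r) :
    realization (complex (fibres c)) ≃ₜ Metric.sphere (0 : E) 1 where
  toFun z := ⟨‖L.symm (coneToVector c z)‖⁻¹ • L.symm (coneToVector c z), by
    have : L.symm (coneToVector c z) ≠ 0 := by
      simpa using coneToVector_ne_zero z.2
    simp [norm_smul, this]⟩
  invFun u := ⟨(∑ v, vectorToCone c (L u) v)⁻¹ • vectorToCone c (L u), by
    have hu : L u ≠ 0 := by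
      simpa using ne_zero_of_mem_unit_sphere u
    have hpos := sum_vectorToCone_pos c hu
    have hcone := smul_mem_realizationCone (vectorToCone_mem c (L u)) (inv_nonneg.2 hpos.le)
    refine mem_realization_complex.2 ⟨⟨hcone.1, ?_⟩, hcone.2⟩
    simp only [Pi.smul_apply, smul_eq_mul, ← Finset.mul_sum]
    exact inv_mul_cancel₀ hpos.ne'⟩
  left_inv z := by
    ext1
    have hz := realization_subset_cone _ z.2
    have hn : 0 < ‖L.symm (coneToVector c z)‖ := by
      simpa using coneToVector_ne_zero z.2
    have hs := (mem_realization_complex.1 z.2).1.2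
    simp only [map_smul, ContinuousLinearEquiv.apply_symm_apply]
    -- By homogeneity the norm factor cancels, since the coordinates of `z` sum to 1.
    rw [vectorToCone_smul c (inv_nonneg.2 hn.le), vectorToCone_coneToVector hz]
    simp only [Pi.smul_apply, smul_eq_mul, ← Finset.mul_sum, hs, mul_one, inv_inv]
    rw [smul_inv_smul₀ hn.ne']
  right_inv u := by
    ext1
    have hu : L u ≠ 0 := by
      simpa using ne_zero_of_mem_unit_sphere u
    have hpos := sum_vectorToCone_pos c hu
    have hu1 : ‖(u : E)‖ = 1 := by simp
    simp only [map_smul, coneToVector_vectorToCone, ContinuousLinearEquiv.symm_apply_apply,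
      norm_smul, norm_inv, hu1, mul_one, inv_inv, Real.norm_of_nonneg hpos.le]
    rw [smul_inv_smul₀ hpos.ne']
  continuous_toFun := by
    have hc : Continuous fun z : realization (complex (fibres c)) =>
        L.symm (coneToVector c z) :=
      L.symm.continuous.comp
        ((LinearMap.continuous_of_finiteDimensional _).comp continuous_subtype_val)
    refine Continuous.subtype_mk (Continuous.smul (hc.norm.inv₀ fun z => ?_) hc) _
    simpa using coneToVector_ne_zero z.2
  continuous_invFun := by
    have hc : Continuous fun u : Metric.sphere (0 : E) 1 => vectorToCone c (L u) :=
      (continuous_vectorToCone c).comp (L.continuous.comp continuous_subtype_val)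
    refine Continuous.subtype_mk (Continuous.smul (Continuous.inv₀
      (continuous_finsetSum _ fun v _ => (continuous_apply v).comp hc) fun u => ?_) hc) _
    refine (sum_vectorToCone_pos c ?_).ne'
    simpa using ne_zero_of_mem_unit_sphere u

end Partition

/-- If the `N i` cover `W`, then `|K(N)|` is homotopy equivalent to the sphere of dimension
`|W| - 1`. -/
theorem nonempty_homotopyEquiv_sphere [Fintype W] {N : Fin r → Finset W}
    (hN : (⋃ i, (N i : Set W)) = Set.univ) :
    Nonempty (realization (complex N) ≃ₕ
      Metric.sphere (0 : EuclideanSpace ℝ (Fin (Fintype.card W))) 1) := by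
  have hmem : ∀ w, ∃ i, w ∈ N i := fun w => Set.mem_iUnion.1 (hN ▸ Set.mem_univ w)
  choose c hc using hmem
  have hsub : ∀ i, fibres c i ⊆ N i := fun i w hw => by
    obtain rfl := mem_fibres.1 hw
    exact hc w
  have hcover : (⋃ i, (fibres c i : Set W)) = Set.univ :=
    Set.eq_univ_of_forall fun w => Set.mem_iUnion.2 ⟨c w, mem_fibres.2 rfl⟩
  obtain ⟨e, -⟩ := isHomotopyEquivalence_realizationInclusion hsub hcover
  -- Any linear isomorphism will do: only rays matter.
  let L : EuclideanSpace ℝ (Fin (Fintype.card W)) ≃L[ℝ] (W → ℝ) :=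
    ContinuousLinearEquiv.ofFinrankEq (by simp)
  exact ⟨e.symm.trans (realizationFibresHomeomorph L c).toHomotopyEquiv⟩

end SimplicialComplexOf

theorem proposition4p2 {W : Type*} [Fintype W] {r : ℕ} (N : Fin r → Finset W) :
    ((⋃ i, (N i : Set W)) = Set.univ →
      Nonempty (SimplicialComplexOf.realization (SimplicialComplexOf.complex N) ≃ₕ
        Metric.sphere (0 : EuclideanSpace ℝ (Fin (Fintype.card W))) 1)) ∧
    ((⋃ i, (N i : Set W)) ≠ Set.univ →
      ContractibleSpace (SimplicialComplexOf.realization (SimplicialComplexOf.complex N))) ∧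
    (∀ (M : Fin r → Finset W) (hMN : ∀ i, M i ⊆ N i), (⋃ i, (M i : Set W)) = Set.univ →
      SimplicialComplexOf.IsHomotopyEquivalence
        (SimplicialComplexOf.realizationInclusion (SimplicialComplexOf.complex_mono hMN))) := by
  exact ⟨SimplicialComplexOf.nonempty_homotopyEquiv_sphere,
    SimplicialComplexOf.contractibleSpace_realization_complex, fun _ hMN hM =>
      SimplicialComplexOf.isHomotopyEquivalence_realizationInclusion hMN hM⟩
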